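/- **Notation.** For $f\in\mathbb{Q}[x,y]$ let $\deg(f,v)$, $\mathrm{lc}(f,v)$ and $\mathrm{discrim}(f,v)$ denote the degree, leading coefficient and discriminant of $f$ with respect to the variable $v$, and let $\mathrm{res}(f_1,f_2,y)$ be the resultant with respect to $y$. The reciprocal polynomial of $f$ is $\mathcal{R}(f)=y^{\deg(f,y)}f(x,1/y)$. For a square-free $f\in\mathbb{Q}[x,y]$ with $\deg(f,y)\ge 1$, the *start-point* $M_f$ is the maximal real root of $\mathrm{lc}(f,y)\cdot\mathrm{discrim}(f,y)$ (with $M_f=-\infty$ if there is no real root). The *terminal-root-functions* of $f$ are the analytic functions $\theta_1<\dots<\theta_r$ on $(M_f,+\infty)$ such that for every $x_0>M_f$ the numbers $\theta_1(x_0)<\dots<\theta_r(x_0)$ are all the real roots of $f(x_0,y)$. For $\delta\in\mathbb{Q}$ such that $\mathrm{res}(\frac{\partial f}{\partial x}+\delta\frac{\partial f}{\partial y},f,y)$ is not the zero polynomial, a natural number $\hat k$ is a *$\delta$-bound-point* of $f$ if $(\hat k+\frac12)\pi$ is an upper bound of $M_f$ and of all real roots of $\mathrm{res}(\frac{\partial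 f}{\partial x}+\delta\frac{\partial f}{\partial y},f,y)$. A *general potential periodic interval set* of $f$ is a list of open intervals $(a_0,b_0),\dots,(a_{s+1},b_{s+1})$ with $s\ge 0$, $a_0=-\infty$, $b_{s+1}=+\infty$, all other end-points rational, $b_0<0$, $a_{s+1}>0$, $a_j<b_j\le a_{j+1}$ for $1\le j\le s$, such that every real root of $\mathrm{lc}(f,x)$ lies in some $(a_j,b_j)$ with $1\le j\le s$, none lies in $(a_0,b_0)$ or $(a_{s+1},b_{s+1})$, and each $(a_j,b_j)$ with $1\le j\le s$ contains at most one real root of $\mathrm{lc}(f,x)$. **Theorem 3.3.** Let $g\in\mathbb{Q}[x,y]$ be square-free with $\deg(g,y)\ge 1$ and $y\nmid g$, and let $h=\mathcal{R}(g)$. Let $\delta_1,\delta_2\in\mathbb{Q}$ with $0<\delta_1<1$ and $-1<\delta_2<0$ be such that neither $\mathrm{res}(\frac{\partial g}{\partial x}+\delta_1\frac{\partial g}{\partial y},g,y)$ nor $\mathrm{res}(\frac{\partial h}{\partial x}+\delta_2\frac{\partial h}{\partial y},h,y)$ is the zero polynomial. Let $(a_0,b_0),\dots,(a_{s+1},b_{s+1})$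 be a general potential periodic interval set of $g$, and let $k'$ be a natural number such that $(k'+\frac12)\pi$ is an upper bound of the start-point $M_g$ and of all real roots of $\prod_{j=0}^{s}g(x,b_j)\,g(x,a_{j+1})$. Let $k''$ be a $\delta_1$-bound-point of $g$ and $k'''$ a $\delta_2$-bound-point of $h$, and set $k^*=\max\{k',k'',k'''\}$. Let $\theta_1,\dots,\theta_r$ be the terminal-root-functions of $g$. Then for every integer $k>k^*$ and every $i\in\{1,\dots,r\}$ there is exactly one $\xi\in(k\pi-\frac{\pi}{2},k\pi+\frac{\pi}{2})$ with $\theta_i(\xi)=\tan\xi$. -/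

import Mathlib

open Polynomial
open scoped Polynomial.Bivariate

noncomputable section

namespace MTP

/-! A polynomial `g ∈ ℚ[x, y]` is an element of `ℚ[X][Y]`: the outer variable is `y`, the
coefficients are polynomials in `x`. So `g.natDegree`, `g.leadingCoeff`, `g.discr` are the degree,
the leading coefficient and the discriminant with respect to `y`. -/

/-- The value `g(x, y)` at a real point. -/
def evalReal (g : ℚ[X][Y]) (x y : ℝ) : ℝ :=
  aevalAeval x y g

/-- The partial derivative `∂g/∂x`. -/
def partialX (g : ℚ[X][Y]) : ℚ[X][Y] :=
  Bivariate.swap (derivative (Bivariate.swap g))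

/-- The partial derivative `∂g/∂y`. -/
def partialY (g : ℚ[X][Y]) : ℚ[X][Y] :=
  derivative g

/-- The leading coefficient of `g` with respect to `x`, a polynomial in `y`. -/
def leadingCoeffX (g : ℚ[X][Y]) : ℚ[X] :=
  (Bivariate.swap g).leadingCoeff

/-- The reciprocal polynomial `g(x, 1/y) * y ^ deg(g, y)`. -/
def reciprocal (g : ℚ[X][Y]) : ℚ[X][Y] :=
  g.reverse

/-- `res(∂g/∂x + δ ∂g/∂y, g, y)`, a polynomial in `x`. -/
def slopeResultant (δ : ℚ) (g : ℚ[X][Y]) : ℚ[X] :=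
  resultant (partialX g + CC δ * partialY g) g

/-- The start-point `M` of the terminal-root-functions of `g`: the maximal real root of
`lc(g, y) * discrim(g, y)`, with `⊥` (that is, `-∞`) if there is no real root. -/
def startPoint (g : ℚ[X][Y]) : WithBot ℝ :=
  ((g.leadingCoeff * g.discr).aroots ℝ).toFinset.max

/-- `θ₁ < ⋯ < θ_r` are the terminal-root-functions of `g`: analytic functions on `(M, +∞)`,
`M` the start-point, such that for each `x ∈ (M, +∞)` the numbers `θ₁(x) < ⋯ < θ_r(x)` are all
the real roots of `g(x, y)`. The values of `θ i` outside `(M, +∞)` are irrelevant. -/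
structure IsTerminalRootFunctions (g : ℚ[X][Y]) {r : ℕ} (θ : Fin r → ℝ → ℝ) : Prop where
  analytic : ∀ i, AnalyticOnNhd ℝ (θ i) {x : ℝ | startPoint g < (x : WithBot ℝ)}
  strictMono : ∀ x : ℝ, startPoint g < (x : WithBot ℝ) → StrictMono fun i => θ i x
  root_iff : ∀ x : ℝ, startPoint g < (x : WithBot ℝ) →
    ∀ y : ℝ, evalReal g x y = 0 ↔ ∃ i, θ i x = y

/-- A general potential periodic interval set of `g`: the open intervals
`(-∞, b 0), (a 1, b 1), …, (a s, b s), (a (s + 1), +∞)` with rational end-points.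
The values `a 0`, `b (s + 1)` and all `a j`, `b j` with `j > s + 1` are not used. -/
structure IsGeneralPeriodicIntervalSet (g : ℚ[X][Y]) (s : ℕ) (a b : ℕ → ℚ) : Prop where
  b_zero_neg : b 0 < 0
  a_last_pos : 0 < a (s + 1)
  lt : ∀ j, 1 ≤ j → j ≤ s → a j < b j
  le : ∀ j, 1 ≤ j → j ≤ s → b j ≤ a (j + 1)
  root_mem : ∀ y : ℝ, aeval y (leadingCoeffX g) = 0 →
    ∃ j, 1 ≤ j ∧ j ≤ s ∧ y ∈ Set.Ioo (a j : ℝ) (b j : ℝ)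
  not_root_left : ∀ y : ℝ, y < (b 0 : ℝ) → aeval y (leadingCoeffX g) ≠ 0
  not_root_right : ∀ y : ℝ, (a (s + 1) : ℝ) < y → aeval y (leadingCoeffX g) ≠ 0
  at_most_one : ∀ j, 1 ≤ j → j ≤ s →
    {y : ℝ | y ∈ Set.Ioo (a j : ℝ) (b j : ℝ) ∧ aeval y (leadingCoeffX g) = 0}.Subsingleton

/-- The polynomial `∏_{j=0}^{s} g(x, b_j) g(x, a_{j+1})` in `x`. -/
def endpointProduct (g : ℚ[X][Y]) (s : ℕ) (a b : ℕ → ℚ) : ℚ[X] :=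
  ∏ j ∈ Finset.range (s + 1), g.eval (C (b j)) * g.eval (C (a (j + 1)))

/-- `M' = (k + 1/2) π` is an upper bound of the start-point of `g` and of all real roots of
`∏_{j=0}^{s} g(x, b_j) g(x, a_{j+1})`. -/
def IsLocationBound (g : ℚ[X][Y]) (s : ℕ) (a b : ℕ → ℚ) (k : ℕ) : Prop :=
  startPoint g ≤ (((k + 1 / 2) * Real.pi : ℝ) : WithBot ℝ) ∧
    ∀ x : ℝ, aeval x (endpointProduct g s a b) = 0 → x ≤ (k + 1 / 2) * Real.pi

/-- `k` is a `δ`-bound-point of `g`: `(k + 1/2) π` is an upper bound of the start-point of `g` and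
of all real roots of `res(∂g/∂x + δ ∂g/∂y, g, y)`. -/
def IsBoundPoint (δ : ℚ) (g : ℚ[X][Y]) (k : ℕ) : Prop :=
  startPoint g ≤ (((k + 1 / 2) * Real.pi : ℝ) : WithBot ℝ) ∧
    ∀ x : ℝ, aeval x (slopeResultant δ g) = 0 → x ≤ (k + 1 / 2) * Real.pi

end MTP

end

namespace MTP

/-! On the `k`-th branch, `θ = tan` means `arctan θ - x = -kπ`, and `arctan θ - x` is strictly
decreasing as soon as `θ' < 1 + θ ^ 2`. A lower bound for `θ` near the left end and `arctan < π/2`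
at the right end then give exactly one crossing. To get the slope bound beyond all the bound-points:
`θ'` never equals `δ₁`, as the resultant would vanish there, so by Darboux it stays on one side. If
`θ' < δ₁ < 1`, the bound is immediate. If `θ' > δ₁ > 0`, then `θ → ∞`; never meeting the level `a (s
+ 1) > 0`, it stays positive. Now `1 / θ` is a root of the reciprocal polynomial whose slope is
never `δ₂`. A slope always below `δ₂ < 0` would make `1 / θ` negative eventually, so `-θ' / θ ^ 2 >
δ₂ > -1`. -/

lemma evalReal_add (p q : ℚ[X][Y]) (x y : ℝ) :
    evalReal (p + q) x y = evalReal p x y + evalReal q x y :=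
  map_add _ p q

lemma evalReal_mul (p q : ℚ[X][Y]) (x y : ℝ) :
    evalReal (p * q) x y = evalReal p x y * evalReal q x y :=
  map_mul _ p q

lemma evalReal_C (p : ℚ[X]) (x y : ℝ) : evalReal (C p) x y = aeval x p :=
  aevalAeval_C x y p

lemma evalReal_monomial (n : ℕ) (p : ℚ[X]) (x y : ℝ) :
    evalReal (monomial n p) x y = aeval x p * y ^ n := by
  have hX : evalReal X x y = y := aevalAeval_Y x y
  rw [← C_mul_X_pow_eq_monomial, evalReal_mul, evalReal_C]
  congr 1
  exact (map_pow (aevalAeval x y) X n).trans (congrArg (· ^ n) hX)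

lemma evalReal_eq_eval₂ (g : ℚ[X][Y]) (x y : ℝ) :
    evalReal g x y = eval₂ (aeval x : ℚ[X] →ₐ[ℚ] ℝ).toRingHom y g := by
  induction g using Polynomial.induction_on' with
  | add p q hp hq => rw [evalReal_add, eval₂_add, hp, hq]
  | monomial n p => rw [evalReal_monomial, eval₂_monomial]; rfl

/-- Evaluating first at a rational `y`, then at a real `x`. -/
lemma aeval_eval_C (g : ℚ[X][Y]) (x : ℝ) (q : ℚ) :
    aeval x (g.eval (C q)) = evalReal g x q := by
  induction g using Polynomial.induction_on' with
  | add p q hp hq => rw [evalReal_add, eval_add, map_add, hp, hq]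
  | monomial n p => rw [evalReal_monomial, eval_monomial, map_mul, map_pow, aeval_C]; rfl

lemma partialX_add (p q : ℚ[X][Y]) : partialX (p + q) = partialX p + partialX q := by
  simp only [partialX, map_add]

lemma partialX_monomial (n : ℕ) (p : ℚ[X]) :
    partialX (monomial n p) = monomial n (derivative p) := by
  induction p using Polynomial.induction_on' with
  | add p q hp hq => rw [map_add, partialX_add, hp, hq, map_add, map_add]
  | monomial m r =>
    rw [partialX, Bivariate.swap_monomial_monomial, derivative_monomial, derivative_monomial,
      ← Polynomial.C_eq_natCast, monomial_mul_C, Bivariate.swap_monomial_monomial]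

/-- The chain rule for a polynomial along the graph of a function. -/
lemma hasDerivAt_evalReal_graph (g : ℚ[X][Y]) {u : ℝ → ℝ} {d x : ℝ} (hu : HasDerivAt u d x) :
    HasDerivAt (fun t => evalReal g t (u t))
      (evalReal (partialX g) x (u x) + d * evalReal (partialY g) x (u x)) x := by
  induction g using Polynomial.induction_on' with
  | add p q hp hq =>
    have h := hp.add hq
    rw [partialX_add, partialY, derivative_add, evalReal_add, evalReal_add]
    refine (h.congr_deriv ?_).congr_of_eventuallyEq (.of_forall fun t => evalReal_add p q t (u t))
    simp only [partialY]
    ring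
  | monomial n p =>
    have h := (p.hasDerivAt_aeval x).mul (hu.pow n)
    rw [partialX_monomial, partialY, derivative_monomial, evalReal_monomial, evalReal_monomial]
    refine (h.congr_deriv ?_).congr_of_eventuallyEq
      (.of_forall fun t => evalReal_monomial n p t (u t))
    simp only [map_mul, map_natCast, Pi.pow_apply]
    ring

/-- A common real zero of two polynomials projects to a zero of the resultant. -/
lemma aeval_resultant_eq_zero {p q : ℚ[X][Y]} (hq : q.natDegree ≠ 0) {x y : ℝ}
    (hp0 : evalReal p x y = 0) (hq0 : evalReal q x y = 0) : aeval x (resultant p q) = 0 := by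
  -- The resultant lies in the ideal generated by `p` and `q`.
  obtain ⟨a, b, -, -, h⟩ := exists_mul_add_mul_eq_C_resultant p q le_rfl le_rfl (.inr hq)
  rw [← evalReal_C _ x y, ← h, evalReal_add, evalReal_mul, evalReal_mul, hp0, hq0]
  simp

/-- A function whose graph lies on `g = 0` has slope `δ` only over the zeros of the
slope resultant. -/
lemma aeval_slopeResultant_eq_zero {δ : ℚ} {g : ℚ[X][Y]} (hg : g.natDegree ≠ 0) {u : ℝ → ℝ}
    {x : ℝ} (hu : HasDerivAt u δ x) (h0 : ∀ᶠ t in nhds x, evalReal g t (u t) = 0) :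
    aeval x (slopeResultant δ g) = 0 := by
  refine aeval_resultant_eq_zero hg (y := u x) ?_ h0.self_of_nhds
  have h1 := hasDerivAt_evalReal_graph g hu
  have h2 : HasDerivAt (fun t => evalReal g t (u t)) 0 x :=
    (hasDerivAt_const x (0 : ℝ)).congr_of_eventuallyEq h0
  have hδ : evalReal (CC δ : ℚ[X][Y]) x (u x) = δ := by
    rw [evalReal_C, aeval_C]; rfl
  rw [evalReal_add, evalReal_mul, hδ]
  exact h1.unique h2

lemma evalReal_reciprocal_inv {g : ℚ[X][Y]} {x y : ℝ} (hy : y ≠ 0) (h : evalReal g x y = 0) :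
    evalReal (reciprocal g) x y⁻¹ = 0 := by
  let := invertibleOfNonzero hy
  rw [evalReal_eq_eval₂] at h ⊢
  rw [← invOf_eq_inv, reciprocal]
  exact (eval₂_reverse_eq_zero_iff _ y g).2 h

/-- The constant coefficient in `y` is nonzero, so reversal loses no degree. This keeps the degree
of the reciprocal positive, as the resultant argument requires. -/
lemma natDegree_reciprocal {g : ℚ[X][Y]} (hy : ¬ (X : ℚ[X][Y]) ∣ g) :
    (reciprocal g).natDegree = g.natDegree := by
  have h0 : g.coeff 0 ≠ 0 := fun h => hy (X_dvd_iff.2 h)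
  rw [reciprocal, reverse_natDegree, natTrailingDegree_eq_zero.2 (.inr h0), Nat.sub_zero]

end MTP

/-- If `f' > c` on a ray, then `f` lies above every line of slope `c` through its graph. -/
lemma mul_sub_lt_sub_of_lt_deriv_Ioi {f f' : ℝ → ℝ} {L c : ℝ}
    (hf : ∀ x ∈ Set.Ioi L, HasDerivAt f (f' x) x) (h : ∀ x ∈ Set.Ioi L, c < f' x)
    {x y : ℝ} (hx : L < x) (hxy : x < y) : c * (y - x) < f y - f x := by
  refine (convex_Ioi L).mul_sub_lt_image_sub_of_lt_deriv
    (fun z hz => (hf z hz).continuousAt.continuousWithinAt) ?_ ?_ x hx y (hx.trans hxy) hxy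
  · rw [interior_Ioi]
    exact fun z hz => (hf z hz).differentiableAt.differentiableWithinAt
  · rw [interior_Ioi]
    exact fun z hz => (hf z hz).deriv ▸ h z hz

/-- A function that is eventually above a level which it never attains on a ray stays above it. -/
lemma lt_of_forall_ne_of_tendsto_atTop {f : ℝ → ℝ} {L c : ℝ} (hf : ContinuousOn f (Set.Ioi L))
    (hne : ∀ x ∈ Set.Ioi L, f x ≠ c) (hlim : Filter.Tendsto f Filter.atTop Filter.atTop)
    {x : ℝ} (hx : L < x) : c < f x := by
  by_contra hle
  obtain ⟨y, hy, hxy⟩ :=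
    ((hlim.eventually_gt_atTop c).and (Filter.eventually_gt_atTop x)).exists
  obtain ⟨z, hz, hzc⟩ := intermediate_value_Icc hxy.le
    (hf.mono fun t ht => hx.trans_le ht.1) ⟨not_lt.1 hle, hy.le⟩
  exact hne z (hx.trans_le hz.1) hzc

/-- On a ray where `f' > 0`, `f → ∞` and `f > 0`, the slope of `1 / f` being never `c > -1`,
`c < 0`, forces `f' < 1 + f ^ 2`. -/
lemma deriv_lt_one_add_sq_of_deriv_inv_ne {f f' : ℝ → ℝ} {L c : ℝ} (hc : c ∈ Set.Ioo (-1 : ℝ) 0)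
    (hf : ∀ x ∈ Set.Ioi L, HasDerivAt f (f' x) x) (hpos : ∀ x ∈ Set.Ioi L, 0 < f x)
    (hne : ∀ x ∈ Set.Ioi L, -f' x / f x ^ 2 ≠ c) {x : ℝ} (hx : L < x) :
    f' x < 1 + f x ^ 2 := by
  have hinv : ∀ x ∈ Set.Ioi L, HasDerivAt (fun t => (f t)⁻¹) (-f' x / f x ^ 2) x :=
    fun x hx => (hf x hx).fun_inv (hpos x hx).ne'
  rcases hasDerivWithinAt_forall_lt_or_forall_gt_of_forall_ne (convex_Ioi L)
    (fun x hx => (hinv x hx).hasDerivWithinAt) hne with h | h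
  · exfalso
    set w := (f x)⁻¹
    have hw : 0 < w := inv_pos.2 (hpos x hx)
    have hc0 : 0 < -c := neg_pos.2 hc.2
    -- The line of slope `c` through `(x, w)` reaches zero at `x + w / -c`.
    have hxy : x < x + w / -c := lt_add_of_pos_right _ (div_pos hw hc0)
    have h1 := mul_sub_lt_sub_of_lt_deriv_Ioi (c := -c) (fun z hz => (hinv z hz).fun_neg)
      (fun z hz => neg_lt_neg (h z hz)) hx hxy
    have h2 : 0 < (f (x + w / -c))⁻¹ := inv_pos.2 (hpos _ (hx.trans hxy))
    have h3 : -c * (x + w / -c - x) = w := by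
      rw [add_sub_cancel_left, mul_div_cancel₀ _ hc0.ne']
    rw [h3] at h1
    change w < -(f (x + w / -c))⁻¹ - -w at h1
    linarith
  · have hsq : 0 < f x ^ 2 := pow_pos (hpos x hx) 2
    have h1 := hc.1.trans (h x hx)
    rw [lt_div_iff₀ hsq] at h1
    linarith

/-- A function on a ray starting at `kπ - π/2` that is bounded below near the start and satisfies
`f' < 1 + f ^ 2` meets the `k`-th branch of the tangent exactly once. -/
lemma existsUnique_eq_tan_of_deriv_lt {f f' : ℝ → ℝ} (k : ℤ)
    (hf : ∀ x ∈ Set.Ioi (k * Real.pi - Real.pi / 2), HasDerivAt f (f' x) x)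
    (hlt : ∀ x ∈ Set.Ioi (k * Real.pi - Real.pi / 2), f' x < 1 + f x ^ 2)
    {c : ℝ} (hc : ∀ x ∈ Set.Ioo (k * Real.pi - Real.pi / 2) (k * Real.pi + Real.pi / 2), c ≤ f x) :
    ∃! ξ : ℝ, ξ ∈ Set.Ioo (k * Real.pi - Real.pi / 2) (k * Real.pi + Real.pi / 2) ∧
      f ξ = Real.tan ξ := by
  have hpi := Real.pi_pos
  set L := k * Real.pi - Real.pi / 2 with hL
  set R := k * Real.pi + Real.pi / 2 with hR
  have hLR : L < R := by linarith
  have hiff : ∀ x ∈ Set.Ioo L R, f x = Real.tan x ↔ Real.arctan (f x) - x = -(k * Real.pi) := by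
    intro x hx
    have htan : Real.arctan (Real.tan x) = x - k * Real.pi := by
      rw [← Real.tan_sub_int_mul_pi x k]
      exact Real.arctan_tan (by linarith [hx.1]) (by linarith [hx.2])
    rw [← Real.arctan_injective.eq_iff, htan]
    constructor <;> intro h <;> linarith
  have hderiv : ∀ x ∈ Set.Ioi L, HasDerivAt (fun t => Real.arctan (f t) - t)
      (1 / (1 + f x ^ 2) * f' x - 1) x :=
    fun x hx => ((hf x hx).arctan).sub (hasDerivAt_id x)
  have hcont : ContinuousOn (fun t => Real.arctan (f t) - t) (Set.Ioi L) :=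
    fun x hx => (hderiv x hx).continuousAt.continuousWithinAt
  have hanti : StrictAntiOn (fun t => Real.arctan (f t) - t) (Set.Ioi L) := by
    refine strictAntiOn_of_deriv_neg (convex_Ioi L) hcont fun x hx => ?_
    rw [interior_Ioi] at hx
    rw [(hderiv x hx).deriv, one_div_mul_eq_div, sub_neg, div_lt_one (by positivity)]
    exact hlt x hx
  -- The bound equals `kπ + arctan c`, so to its left `arctan c - x > -kπ`.
  obtain ⟨x, hx, hxc⟩ : ∃ x ∈ Set.Ioo L R, x < L + (Real.arctan c + Real.pi / 2) := by
    have := Real.neg_pi_div_two_lt_arctan c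
    obtain ⟨x, hx1, hx2⟩ :=
      exists_between (lt_min hLR (show L < L + (Real.arctan c + Real.pi / 2) by linarith))
    exact ⟨x, ⟨hx1, hx2.trans_le (min_le_left _ _)⟩, hx2.trans_le (min_le_right _ _)⟩
  have hleft : -(k * Real.pi) < Real.arctan (f x) - x := by
    have := Real.arctan_strictMono.monotone (hc x hx)
    linarith
  have hright : Real.arctan (f R) - R < -(k * Real.pi) := by
    have := Real.arctan_lt_pi_div_two (f R)
    linarith
  obtain ⟨ξ, hξ, hξ0⟩ := intermediate_value_Ioo' hx.2.le
    (hcont.mono fun t ht => hx.1.trans_le ht.1) ⟨hright, hleft⟩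
  have hξmem : ξ ∈ Set.Ioo L R := ⟨hx.1.trans hξ.1, hξ.2⟩
  refine ⟨ξ, ⟨hξmem, (hiff ξ hξmem).2 hξ0⟩, fun η hη => ?_⟩
  exact hanti.injOn hη.1.1 hξmem.1 (((hiff η hη.1).1 hη.2).trans hξ0.symm)

theorem theorem3p3 (g : ℚ[X][Y]) (hsq : Squarefree g) (hdeg : 1 ≤ g.natDegree)
    (hy : ¬ (Polynomial.X : ℚ[X][Y]) ∣ g)
    (δ₁ δ₂ : ℚ) (hδ₁ : δ₁ ∈ Set.Ioo (0 : ℚ) 1) (hδ₂ : δ₂ ∈ Set.Ioo (-1 : ℚ) 0)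
    (hres₁ : MTP.slopeResultant δ₁ g ≠ 0)
    (hres₂ : MTP.slopeResultant δ₂ (MTP.reciprocal g) ≠ 0)
    (s : ℕ) (a b : ℕ → ℚ) (hI : MTP.IsGeneralPeriodicIntervalSet g s a b)
    (k' k'' k''' : ℕ) (hk' : MTP.IsLocationBound g s a b k')
    (hk'' : MTP.IsBoundPoint δ₁ g k'')
    (hk''' : MTP.IsBoundPoint δ₂ (MTP.reciprocal g) k''')
    (r : ℕ) (θ : Fin r → ℝ → ℝ) (hθ : MTP.IsTerminalRootFunctions g θ)
    (k : ℤ) (hk : ((max k' (max k'' k''') : ℕ) : ℤ) < k) (i : Fin r) :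
    ∃! ξ : ℝ, ξ ∈ Set.Ioo (k * Real.pi - Real.pi / 2) (k * Real.pi + Real.pi / 2) ∧
      θ i ξ = Real.tan ξ := by
  have hπ := Real.pi_pos
  set L := k * Real.pi - Real.pi / 2 with hL
  -- As `k` is an integer, `n < k` gives `n + 1 ≤ k`, which absorbs both half-periods.
  have hbound : ∀ n : ℕ, n ≤ max k' (max k'' k''') → ((n : ℝ) + 1 / 2) * Real.pi ≤ L := by
    intro n hn
    have h1 : (n : ℤ) + 1 ≤ k := by omega
    have h2 : (n : ℝ) + 1 ≤ k := by exact_mod_cast h1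
    nlinarith
  have hL' := hbound k' (by simp)
  have hL'' := hbound k'' (by simp)
  have hL''' := hbound k''' (by simp)
  have hstart : ∀ x ∈ Set.Ioi L, MTP.startPoint g < (x : WithBot ℝ) := fun x hx =>
    hk'.1.trans_lt (WithBot.coe_lt_coe.2 (hL'.trans_lt hx))
  have hroot : ∀ x ∈ Set.Ioi L, MTP.evalReal g x (θ i x) = 0 := fun x hx =>
    (hθ.root_iff x (hstart x hx) _).2 ⟨i, rfl⟩
  have hderiv : ∀ x ∈ Set.Ioi L, HasDerivAt (θ i) (deriv (θ i) x) x := fun x hx =>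
    (hθ.analytic i x (hstart x hx)).differentiableAt.hasDerivAt
  have hcont : ContinuousOn (θ i) (Set.Ioi L) := fun x hx =>
    (hderiv x hx).continuousAt.continuousWithinAt
  have hδ₁pos : (0 : ℝ) < δ₁ := by exact_mod_cast hδ₁.1
  have hδ₁lt : (δ₁ : ℝ) < 1 := by exact_mod_cast hδ₁.2
  have hslope : ∀ x ∈ Set.Ioi L, deriv (θ i) x ≠ δ₁ := by
    intro x hx h
    have h0 := MTP.aeval_slopeResultant_eq_zero (by omega) (h ▸ hderiv x hx)
      (Filter.eventually_of_mem (Ioi_mem_nhds hx) hroot)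
    exact absurd (hk''.2 x h0) (not_le.2 (hL''.trans_lt hx))
  rcases hasDerivWithinAt_forall_lt_or_forall_gt_of_forall_ne (convex_Ioi L)
    (fun x hx => (hderiv x hx).hasDerivWithinAt) hslope with h | h
  · set R := k * Real.pi + Real.pi / 2 with hR
    have hLR : L < R := by linarith
    refine existsUnique_eq_tan_of_deriv_lt k hderiv
      (fun x hx => by nlinarith [h x hx, sq_nonneg (θ i x)])
      -- Going left from `R`, `θ i` drops by less than `δ₁ * (R - L)`.
      (c := θ i R - δ₁ * (R - L)) fun x hx => ?_
    have h1 := mul_sub_lt_sub_of_lt_deriv_Ioi (c := -(δ₁ : ℝ)) (fun z hz => (hderiv z hz).fun_neg)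
      (fun z hz => neg_lt_neg (h z hz)) hx.1 hx.2
    nlinarith [hx.1]
  · have hlim : Filter.Tendsto (θ i) Filter.atTop Filter.atTop := by
      -- Comparison with a line of slope `δ₁`, based at `L + 1` because `L` is not in the open ray.
      refine Filter.tendsto_atTop_mono' _ (f₁ := fun x => (δ₁ : ℝ) * (x - (L + 1)) + θ i (L + 1))
        ?_ ?_
      · filter_upwards [Filter.eventually_gt_atTop (L + 1)] with x hx
        linarith [mul_sub_lt_sub_of_lt_deriv_Ioi hderiv h (lt_add_one L) hx]
      · exact Filter.tendsto_atTop_add_const_right _ _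
          ((Filter.tendsto_atTop_add_const_right _ _ Filter.tendsto_id).const_mul_atTop hδ₁pos)
    have hlast : (0 : ℝ) < a (s + 1) := by exact_mod_cast hI.a_last_pos
    have hpos : ∀ x ∈ Set.Ioi L, 0 < θ i x := by
      refine fun x hx => hlast.trans
        (lt_of_forall_ne_of_tendsto_atTop hcont (fun y hy h => ?_) hlim hx)
      refine absurd (hk'.2 y ?_) (not_le.2 (hL'.trans_lt hy))
      rw [MTP.endpointProduct, map_prod]
      -- The factor `j = s` contains `g(x, a (s + 1))`.
      refine Finset.prod_eq_zero (Finset.self_mem_range_succ s) ?_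
      rw [map_mul, MTP.aeval_eval_C g y (a (s + 1)), ← h, hroot y hy, mul_zero]
    refine existsUnique_eq_tan_of_deriv_lt k hderiv (fun x hx => ?_) (c := 0)
      fun x hx => (hpos x hx.1).le
    refine deriv_lt_one_add_sq_of_deriv_inv_ne (c := (δ₂ : ℝ))
      ⟨by exact_mod_cast hδ₂.1, by exact_mod_cast hδ₂.2⟩ hderiv hpos (fun y hLy hδ => ?_) hx
    have hinv := (hderiv y hLy).fun_inv (hpos y hLy).ne'
    rw [hδ] at hinv
    have h0 := MTP.aeval_slopeResultant_eq_zero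
      (by rw [MTP.natDegree_reciprocal hy]; omega) hinv
      (Filter.eventually_of_mem (Ioi_mem_nhds hLy) fun z hz =>
        MTP.evalReal_reciprocal_inv (hpos z hz).ne' (hroot z hz))
    exact absurd (hk'''.2 y h0) (not_le.2 (hL'''.trans_lt hLy))
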